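/- **Setting.** An $M$-user discrete memoryless multiple-access channel has finite input alphabets $\mathcal X_1,\dots,\mathcal X_M$, a finite output alphabet $\mathcal Y$ and transition probabilities $W(y\mid x_1,\dots,x_M)$. Fix a product input distribution $P_{X_1}\cdots P_{X_M}$, so that the inputs $X_1,\dots,X_M$ and the output $Y$ have joint law $\prod_i P_{X_i}(x_i)\,W(y\mid x_1,\dots,x_M)$. Write $[M]=\{1,\dots,M\}$, $X_{\mathcal S}=(X_i)_{i\in\mathcal S}$, $\mathcal S^c=[M]\setminus\mathcal S$ and $R(\mathcal S)=\sum_{i\in\mathcal S}R_i$, and let $$\mathcal R=\{R\in\mathbb R_+^M:\ R(\mathcal S)\le I(X_{\mathcal S};Y\mid X_{\mathcal S^c})\ \text{ for all }\mathcal S\subseteq[M]\}.$$ The region $\mathcal R$ is *non-degenerated* if $I(X_{\mathcal S};Y)>0$ for all non-empty $\mathcal S\subseteq[M]$, and $I(X_{\mathcal S};Y\mid X_{\mathcal A})<I(X_{\mathcal S};Y\mid X_{\mathcal B})$ for all $\emptyset\subsetneq\mathcal S\subsetneq[M]$ and $\mathcal A\subsetneq\mathcal B\subsetneq[M]$ with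 $\mathcal S\cap\mathcal B=\emptyset$. A *face* of $\mathcal R$ is a set $\mathcal R\cap\{R\in\mathbb R_+^M: Ra=a_0\}$, where the linear inequality $Ra\le a_0$ holds for all $R\in\mathcal R$; the dimension of a non-empty face is that of its affine hull. For non-empty sets $\mathcal S_1,\dots,\mathcal S_m\subseteq[M]$ ($m\ge 0$) and $\mathcal A\subseteq[M]$ let $$\mathcal F_{\mathcal S_1,\dots,\mathcal S_m|\mathcal A}=\{R\in\mathcal R:\ R(\mathcal S_j)=I(X_{\mathcal S_j};Y\mid X_{\mathcal S_j^c})\ (1\le j\le m),\ R_i=0\ (i\in\mathcal A)\}.$$ A face of this form is a *front face* if it can be written so with $\mathcal A=\emptyset$, and a *back face* if it can be written so with $\mathcal A\ne\emptyset$. **Proposition.** Let $M,D\ge 0$ be integers. Let $N_b(M,D)$ be the number of $D$-dimensional back faces of a non-degenerated region of an $M$-user channel, and let $N_f(i,D)$ be the number of $D$-dimensional front faces of a non-degenerated region of an $i$-user channel (the region of a channel with $0$ users is a single point). Then, whichever non-degenerated regions are chosen for $M$ and for each $i$ with $D\le i\le M-1$, $$N_b(M,D)=\sum_{i=D}^{M-1}\binom{M}{i}\,N_f(i,D).$$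 -/

import Mathlib

universe u v u' v'

noncomputable section

open Classical in
/-- Shannon entropy (in nats) of the random variable `U` on the finite probability space `Ω` with
probability mass function `p`. The base of the logarithm only fixes the unit of rates. -/
def shannonEntropy {Ω : Type*} {α : Type*} [Fintype Ω] [Fintype α] (p : Ω → ℝ) (U : Ω → α) : ℝ :=
  ∑ a : α, Real.negMulLog (∑ ω : Ω with U ω = a, p ω)

/-- Mutual information `I(U;V) = H(U) + H(V) - H(U,V)`. -/
def mutualInfo {Ω : Type*} {α : Type*} {β : Type*} [Fintype Ω] [Fintype α] [Fintype β]
    (p : Ω → ℝ) (U : Ω → α) (V : Ω → β) : ℝ :=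
  shannonEntropy p U + shannonEntropy p V - shannonEntropy p (fun ω => (U ω, V ω))

/-- Conditional mutual information
`I(U;V|Z) = H(U|Z) - H(U|V,Z) = H(U,Z) + H(V,Z) - H(U,V,Z) - H(Z)`. -/
def condMutualInfo {Ω : Type*} {α : Type*} {β : Type*} {γ : Type*}
    [Fintype Ω] [Fintype α] [Fintype β] [Fintype γ]
    (p : Ω → ℝ) (U : Ω → α) (V : Ω → β) (Z : Ω → γ) : ℝ :=
  shannonEntropy p (fun ω => (U ω, Z ω)) + shannonEntropy p (fun ω => (V ω, Z ω))
    - shannonEntropy p (fun ω => (U ω, V ω, Z ω)) - shannonEntropy p Z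

/-- An `M`-user discrete memoryless multiple-access channel (finite alphabets `X i` and `Y`,
transition probabilities `W`) together with a product input distribution `P`. -/
structure MAC (M : ℕ) where
  X : Fin M → Type u
  Y : Type v
  [fintypeX : ∀ i, Fintype (X i)]
  [fintypeY : Fintype Y]
  W : (∀ i, X i) → PMF Y
  P : ∀ i, PMF (X i)

namespace MAC

attribute [instance] MAC.fintypeX MAC.fintypeY

variable {M : ℕ} (C : MAC.{u, v} M)

/-- The joint probability mass function of inputs and output. -/
def joint (ω : (∀ i, C.X i) × C.Y) : ℝ :=
  (∏ i, (C.P i (ω.1 i)).toReal) * (C.W ω.1 ω.2).toReal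

/-- The random variable `X_S = (X_i)_{i ∈ S}`. -/
def inp (S : Finset (Fin M)) (ω : (∀ i, C.X i) × C.Y) : ∀ i : S, C.X i :=
  fun i => ω.1 i

/-- The random variable `Y`. -/
def out (ω : (∀ i, C.X i) × C.Y) : C.Y := ω.2

/-- `I(X_S; Y)`. -/
def info (S : Finset (Fin M)) : ℝ :=
  mutualInfo C.joint (C.inp S) C.out

/-- `I(X_S; Y | X_T)`. -/
def condInfo (S T : Finset (Fin M)) : ℝ :=
  condMutualInfo C.joint (C.inp S) C.out (C.inp T)

/-- The region: all `R ∈ ℝ₊^M` with `R(S) ≤ I(X_S; Y | X_{Sᶜ})` for all `S ⊆ [M]`. -/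
def region : Set (Fin M → ℝ) :=
  {R | (∀ i, 0 ≤ R i) ∧ ∀ S : Finset (Fin M), ∑ i ∈ S, R i ≤ C.condInfo S Sᶜ}

/-- The region is non-degenerated. -/
def NonDegenerated : Prop :=
  (∀ S : Finset (Fin M), S.Nonempty → 0 < C.info S) ∧
  ∀ S A B : Finset (Fin M), ∅ ⊂ S → S ⊂ Finset.univ → A ⊂ B → B ⊂ Finset.univ → S ∩ B = ∅ →
    C.condInfo S A < C.condInfo S B

/-- A face of the region: its intersection with `{R ∈ ℝ₊^M : R a = a₀}` where `R a ≤ a₀` is a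
valid inequality. -/
def IsFace (F : Set (Fin M → ℝ)) : Prop :=
  ∃ (a : Fin M → ℝ) (a₀ : ℝ), (∀ R ∈ C.region, ∑ i, R i * a i ≤ a₀) ∧
    F = C.region ∩ {R | (∀ i, 0 ≤ R i) ∧ ∑ i, R i * a i = a₀}

/-- The back facet `B_i`. -/
def backFacet (i : Fin M) : Set (Fin M → ℝ) :=
  C.region ∩ {R | (∀ j, 0 ≤ R j) ∧ R i = 0}

/-- The front facet `F_S`. -/
def frontFacet (S : Finset (Fin M)) : Set (Fin M → ℝ) :=
  C.region ∩ {R | (∀ j, 0 ≤ R j) ∧ ∑ i ∈ S, R i = C.condInfo S Sᶜ}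

/-- The set `F_{S₁,…,S_m|A}`, where `𝒮 = {S₁,…,S_m}`; intersections over an empty family of facets
are the whole region. -/
def labelledFace (𝒮 : Finset (Finset (Fin M))) (A : Finset (Fin M)) : Set (Fin M → ℝ) :=
  (C.region ∩ ⋂ S ∈ 𝒮, C.frontFacet S) ∩ (C.region ∩ ⋂ i ∈ A, C.backFacet i)

/-- A front face is a face of the form `F_{S₁,…,S_m|∅}` with non-empty `S₁,…,S_m`. -/
def IsFrontFace (F : Set (Fin M → ℝ)) : Prop :=
  C.IsFace F ∧ ∃ 𝒮 : Finset (Finset (Fin M)), (∀ S ∈ 𝒮, S.Nonempty) ∧ F = C.labelledFace 𝒮 ∅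

/-- A back face is a face of the form `F_{S₁,…,S_m|A}` with non-empty `S₁,…,S_m` and `A ≠ ∅`. -/
def IsBackFace (F : Set (Fin M → ℝ)) : Prop :=
  C.IsFace F ∧ ∃ (𝒮 : Finset (Finset (Fin M))) (A : Finset (Fin M)),
    (∀ S ∈ 𝒮, S.Nonempty) ∧ A.Nonempty ∧ F = C.labelledFace 𝒮 A

/-- `F` is a (non-empty) set whose affine hull has dimension `D`. -/
def HasDim (F : Set (Fin M → ℝ)) (D : ℕ) : Prop :=
  F.Nonempty ∧ Module.finrank ℝ (affineSpan ℝ F).direction = D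

/-- The number of `D`-dimensional front faces. (There are finitely many labels, so the set being
counted is finite.) -/
def numFrontFaces (D : ℕ) : ℕ :=
  {F : Set (Fin M → ℝ) | C.IsFrontFace F ∧ HasDim F D}.ncard

/-- The number of `D`-dimensional back faces. -/
def numBackFaces (D : ℕ) : ℕ :=
  {F : Set (Fin M → ℝ) | C.IsBackFace F ∧ HasDim F D}.ncard

end MAC

end

/-! ### Faces of strict polymatroids and their labels. -/

section Polymatroid

open Finset Filter Topology

variable {V : Type*} [Fintype V] [DecidableEq V]

/-! By the chain rule, the bound g(S) on R(S) equals I(X_[M];Y) - I(X_{Sᶜ};Y), and non-degeneracy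
makes g a strict polymatroid function (`NonDegenerated.isStrictPolymatroid`). Strict submodularity
forces tight sets to be nested; strict monotonicity keeps a tight set from containing a vanishing
coordinate. So a non-empty face is labelled by a chain 𝒮 of non-empty sets disjoint from A
(`isFaceLabel`). Conversely, every such label has a face with a point where no other constraint is
tight (`exists_relint`). Hence the label is unique (`label_subset`) and the dimension is M - #𝒮 - #A
(`vectorSpan_face`, `finrank_ker`). Counting faces is thus counting chains, independently of the
channel. A back face of dimension D amounts to a proper subset Aᶜ of some size i and a chain of i -
D non-empty subsets of it, which is a front-face label for i users. -/

/-- A normalized, strictly increasing and strictly submodular set function. -/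
structure IsStrictPolymatroid (g : Finset V → ℝ) : Prop where
  empty : g ∅ = 0
  strictMono : ∀ S T, S ⊂ T → g S < g T
  submodular : ∀ S T, ¬ S ⊆ T → ¬ T ⊆ S → g (S ∪ T) + g (S ∩ T) < g S + g T

/-- The face of the polymatroid of `g` cut out by tightness on `𝒮` and vanishing on `A`. -/
def polymatroidFace (g : Finset V → ℝ) (𝒮 : Finset (Finset V)) (A : Finset V) : Set (V → ℝ) :=
  {R | (∀ i, 0 ≤ R i) ∧ (∀ S, ∑ i ∈ S, R i ≤ g S) ∧ (∀ S ∈ 𝒮, ∑ i ∈ S, R i = g S) ∧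
    ∀ i ∈ A, R i = 0}

/-- The labels of non-empty faces: chains of non-empty sets, all of them disjoint from `A`. -/
structure IsFaceLabel (𝒮 : Finset (Finset V)) (A : Finset V) : Prop where
  nonempty : ∀ S ∈ 𝒮, S.Nonempty
  disjoint : ∀ S ∈ 𝒮, Disjoint S A
  chain : ∀ S ∈ 𝒮, ∀ T ∈ 𝒮, S ⊆ T ∨ T ⊆ S

omit [Fintype V] in
theorem IsStrictPolymatroid.submodular_le {g : Finset V → ℝ} (hg : IsStrictPolymatroid g)
    (S T : Finset V) : g (S ∪ T) + g (S ∩ T) ≤ g S + g T := by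
  by_cases h1 : S ⊆ T
  · rw [union_eq_right.2 h1, inter_eq_left.2 h1, add_comm]
  by_cases h2 : T ⊆ S
  · rw [union_eq_left.2 h2, inter_eq_right.2 h2]
  exact (hg.submodular S T h1 h2).le

omit [Fintype V] in
theorem IsStrictPolymatroid.mono {g : Finset V → ℝ} (hg : IsStrictPolymatroid g)
    {S T : Finset V} (h : S ⊆ T) : g S ≤ g T := by
  rcases h.eq_or_ssubset with rfl | h
  · exact le_rfl
  · exact (hg.strictMono _ _ h).le

/-- The greedy point of a submodular function along an injective key. -/
theorem exists_greedy_of_key {K : Type*} [LinearOrder K] (k : V → K)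
    (hk : Function.Injective k) (g : Finset V → ℝ) (h0 : g ∅ = 0)
    (hg : ∀ S T, g (S ∪ T) + g (S ∩ T) ≤ g S + g T) :
    ∃ R : V → ℝ, (∀ S, ∑ i ∈ S, R i ≤ g S) ∧
      (∀ S : Finset V, (∀ i ∈ S, ∀ j, k j ≤ k i → j ∈ S) → ∑ i ∈ S, R i = g S) ∧
      ∀ i, ∃ T, i ∉ T ∧ R i = g (insert i T) - g T := by
  let below (i : V) : Finset V := univ.filter fun j => k j < k i
  have hbelow : ∀ i, i ∉ below i := fun i => by simp [below]
  refine ⟨fun i => g (insert i (below i)) - g (below i), fun S => ?_, fun S => ?_,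
    fun i => ⟨below i, hbelow i, rfl⟩⟩
  · induction S using Finset.induction_on_max_value k with
    | empty => simp [h0]
    | insert i S hi hmax ih =>
      rw [sum_insert hi]
      have hS : S ⊆ below i := fun j hj => by
        simp only [below, mem_filter, mem_univ, true_and]
        exact lt_of_le_of_ne (hmax j hj) fun h => hi (hk h ▸ hj)
      -- Diminishing returns: the gain of `i` over `below i` is at most its gain over the smaller
      -- set `S`.
      have := hg (insert i S) (below i)
      rw [insert_union, union_eq_right.2 hS, insert_inter_of_notMem (hbelow i),
        inter_eq_left.2 hS] at this
      linarith
  · induction S using Finset.induction_on_max_value k with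
    | empty => simp [h0]
    | insert i S hi hmax ih =>
      intro hin
      have hS : S = below i := by
        ext j
        simp only [below, mem_filter, mem_univ, true_and]
        constructor
        · exact fun hj => lt_of_le_of_ne (hmax j hj) fun h => hi (hk h ▸ hj)
        · intro hj
          rcases mem_insert.1 (hin i (mem_insert_self i S) j hj.le) with rfl | h
          · exact absurd hj (lt_irrefl _)
          · exact h
      have hin' : ∀ a ∈ S, ∀ j, k j ≤ k a → j ∈ S := by
        intro a ha j hj
        rcases mem_insert.1 (hin a (mem_insert_of_mem ha) j hj) with rfl | h
        · exact absurd (hk (le_antisymm hj (hmax a ha))) fun h => hi (h ▸ ha)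
        · exact h
      rw [sum_insert hi, ih hin', ← hS]
      ring

/-- A submodular function has a greedy point that is tight on a given chain. -/
theorem exists_greedy_of_chain (g : Finset V → ℝ) (h0 : g ∅ = 0)
    (hg : ∀ S T, g (S ∪ T) + g (S ∩ T) ≤ g S + g T) (𝒮 : Finset (Finset V))
    (hc : ∀ S ∈ 𝒮, ∀ T ∈ 𝒮, S ⊆ T ∨ T ⊆ S) :
    ∃ R : V → ℝ, (∀ S, ∑ i ∈ S, R i ≤ g S) ∧ (∀ S ∈ 𝒮, ∑ i ∈ S, R i = g S) ∧
      ∀ i, ∃ T, i ∉ T ∧ R i = g (insert i T) - g T := by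
  let e := Fintype.equivFin V
  -- Sorting by the number of chain members that miss `i` makes every chain member an initial
  -- segment; `e` only breaks ties.
  let c (i : V) : ℕ := #{S ∈ 𝒮 | i ∉ S}
  obtain ⟨R, h1, h2, h3⟩ := exists_greedy_of_key (fun i => toLex (c i, e i))
    (fun i j h => e.injective (Prod.ext_iff.1 (toLex.injective h)).2) g h0 hg
  refine ⟨R, h1, fun S hS => h2 S fun i hi j hj => ?_, h3⟩
  by_contra hjS
  have hlt : c i < c j := by
    refine card_lt_card ⟨fun T hT => ?_, fun h => ?_⟩
    · simp only [mem_filter] at hT ⊢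
      refine ⟨hT.1, fun hjT => ?_⟩
      rcases hc S hS T hT.1 with h | h
      · exact hT.2 (h hi)
      · exact hjS (h hjT)
    · have := h (mem_filter.2 ⟨hS, hjS⟩)
      exact (mem_filter.1 this).2 hi
  rcases Prod.Lex.toLex_le_toLex.1 hj with h | h
  · exact absurd h hlt.asymm
  · exact absurd h.1 hlt.ne'

/-- Used to keep finitely many strict inequalities valid for one common small ε > 0. -/
theorem eventually_add_mul_lt {a b : ℝ} (c : ℝ) (h : a < b) :
    ∀ᶠ ε in 𝓝[>] (0 : ℝ), a + ε * c < b := by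
  have : Tendsto (fun ε : ℝ => a + ε * c) (𝓝 0) (𝓝 (a + 0 * c)) :=
    (by fun_prop : Continuous fun ε : ℝ => a + ε * c).tendsto 0
  exact (this.mono_left nhdsWithin_le_nhds).eventually (gt_mem_nhds (by simpa using h))

/-- A strict polymatroid stays one when it is lowered slightly outside of a given family. -/
theorem IsStrictPolymatroid.exists_perturbation {g : Finset V → ℝ} (hg : IsStrictPolymatroid g)
    (𝒮 : Finset (Finset V)) :
    ∃ g' : Finset V → ℝ, IsStrictPolymatroid g' ∧ (∀ S, g' S ≤ g S) ∧ (∀ S ∈ 𝒮, g' S = g S) ∧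
      ∀ S, S.Nonempty → S ∉ 𝒮 → g' S < g S := by
  -- The coefficients 1 here and 2 in `e2` count the terms on the larger side, each of which may be
  -- lowered by up to ε.
  have e1 : ∀ᶠ ε in 𝓝[>] (0 : ℝ), ∀ S T, S ⊂ T → g S + ε * 1 < g T := by
    refine eventually_all.2 fun S => eventually_all.2 fun T => ?_
    by_cases h : S ⊂ T
    · filter_upwards [eventually_add_mul_lt 1 (hg.strictMono S T h)] with ε hε _ using hε
    · exact Eventually.of_forall fun _ h' => absurd h' h
  have e2 : ∀ᶠ ε in 𝓝[>] (0 : ℝ), ∀ S T, ¬ S ⊆ T → ¬ T ⊆ S →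
      g (S ∪ T) + g (S ∩ T) + ε * 2 < g S + g T := by
    refine eventually_all.2 fun S => eventually_all.2 fun T => ?_
    by_cases h : ¬ S ⊆ T ∧ ¬ T ⊆ S
    · filter_upwards [eventually_add_mul_lt 2 (hg.submodular S T h.1 h.2)] with ε hε _ _ using hε
    · exact Eventually.of_forall fun _ h1 h2 => absurd ⟨h1, h2⟩ h
  obtain ⟨ε, ⟨h1, h2⟩, hε⟩ := ((e1.and e2).and self_mem_nhdsWithin).exists
  have hε : 0 < ε := hε
  let d (S : Finset V) : ℝ := if S.Nonempty ∧ S ∉ 𝒮 then ε else 0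
  have d0 : ∀ S, 0 ≤ d S := fun S => by dsimp only [d]; split_ifs <;> linarith
  have d1 : ∀ S, d S ≤ ε := fun S => by dsimp only [d]; split_ifs <;> linarith
  refine ⟨fun S => g S - d S, ⟨by simp [d, hg.empty], fun S T h => ?_, fun S T hS hT => ?_⟩,
    fun S => by linarith [d0 S], fun S hS => by simp [d, hS], fun S hS hS' => ?_⟩
  · linarith [h1 S T h, d0 S, d1 T]
  · linarith [h2 S T hS hT, d0 (S ∪ T), d0 (S ∩ T), d1 S, d1 T]
  · simp only [d, hS, hS', not_false_eq_true, and_self, if_true]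
    linarith

/-- The face with a given label has a point at which no other constraint is tight. -/
theorem IsStrictPolymatroid.exists_relint {g : Finset V → ℝ} (hg : IsStrictPolymatroid g)
    {𝒮 : Finset (Finset V)} {A : Finset V} (hl : IsFaceLabel 𝒮 A) :
    ∃ R ∈ polymatroidFace g 𝒮 A, (∀ i, i ∉ A → 0 < R i) ∧
      ∀ S, S.Nonempty → S ∉ 𝒮 → ∑ i ∈ S, R i < g S := by
  obtain ⟨g', hg', hle, heq, hlt⟩ := hg.exists_perturbation 𝒮
  -- Deleting `A` makes the gains of its elements vanish, while all other gains stay positive. Using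
  -- `g'` instead of `g` leaves every constraint outside `𝒮` slack.
  obtain ⟨R, h1, h2, h3⟩ := exists_greedy_of_chain (fun S => g' (S \ A)) (by simp [hg'.empty])
    (fun S T => by
      have := hg'.submodular_le (S \ A) (T \ A)
      rwa [← union_sdiff_distrib, show S \ A ∩ (T \ A) = (S ∩ T) \ A from
        inf_sdiff.symm] at this) 𝒮 hl.chain
  have hA : ∀ i ∈ A, R i = 0 := fun i hi => by
    obtain ⟨T, -, h⟩ := h3 i
    rw [h, insert_sdiff_of_mem _ hi, sub_self]
  have hpos : ∀ i, i ∉ A → 0 < R i := fun i hi => by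
    obtain ⟨T, hT, h⟩ := h3 i
    rw [h, insert_sdiff_of_notMem _ hi, sub_pos]
    exact hg'.strictMono _ _ (ssubset_insert fun h => hT (mem_sdiff.1 h).1)
  refine ⟨R, ⟨fun i => ?_, fun S => ?_, fun S hS => ?_, hA⟩, hpos, fun S hS hS' => ?_⟩
  · by_cases hi : i ∈ A
    · exact (hA i hi).ge
    · exact (hpos i hi).le
  · exact ((h1 S).trans (hg'.mono sdiff_subset)).trans (hle S)
  · rw [h2 S hS, sdiff_eq_self_of_disjoint (hl.disjoint S hS), heq S hS]
  · exact ((h1 S).trans (hg'.mono sdiff_subset)).trans_lt (hlt S hS hS')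

omit [Fintype V] in
/-- A non-empty face is labelled by a chain of sets disjoint from `A`. -/
theorem IsStrictPolymatroid.isFaceLabel {g : Finset V → ℝ} (hg : IsStrictPolymatroid g)
    {𝒮 : Finset (Finset V)} {A : Finset V} (hne : ∀ S ∈ 𝒮, S.Nonempty)
    (hF : (polymatroidFace g 𝒮 A).Nonempty) : IsFaceLabel 𝒮 A := by
  obtain ⟨R, -, hR, ht, hA⟩ := hF
  refine ⟨hne, fun S hS => disjoint_left.2 fun i hiS hiA => ?_, fun S hS T hT => ?_⟩
  -- Removing an `i` with `R i = 0` keeps the sum at `g S`, above the bound for `S.erase i`.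
  · have h1 := hR (S.erase i)
    have h2 := hg.strictMono _ _ (erase_ssubset hiS)
    have h3 := add_sum_erase S R hiS
    rw [ht S hS, hA i hiA] at h3
    linarith
  -- Uncrossing: two crossing tight sets would violate the constraint on their union or their
  -- intersection.
  · by_contra! h
    have h1 := hg.submodular S T h.1 h.2
    have h2 := sum_union_inter (s₁ := S) (s₂ := T) (f := R)
    rw [ht S hS, ht T hT] at h2
    linarith [hR (S ∪ T), hR (S ∩ T)]

/-- A face determines its label. -/
theorem IsStrictPolymatroid.label_subset {g : Finset V → ℝ} (hg : IsStrictPolymatroid g)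
    {𝒮 𝒯 : Finset (Finset V)} {A B : Finset V} (h𝒮 : IsFaceLabel 𝒮 A) (h𝒯 : IsFaceLabel 𝒯 B)
    (h : polymatroidFace g 𝒯 B ⊆ polymatroidFace g 𝒮 A) : 𝒮 ⊆ 𝒯 ∧ A ⊆ B := by
  obtain ⟨R, hR, hpos, hlt⟩ := hg.exists_relint h𝒯
  obtain ⟨-, -, ht, hA⟩ := h hR
  constructor
  · intro S hS
    by_contra hS'
    exact (hlt S (h𝒮.nonempty S hS) hS').ne (ht S hS)
  · intro i hi
    by_contra hi'
    exact (hpos i hi').ne' (hA i hi)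

/-! ### Dimension of a labelled face. -/

omit [Fintype V] in
/-- The functionals of a label take arbitrary values. -/
theorem IsFaceLabel.exists_values {𝒮 : Finset (Finset V)} {A : Finset V}
    (hl : IsFaceLabel 𝒮 A) (c : Finset V → ℝ) (a : V → ℝ) :
    ∃ v : V → ℝ, (∀ S ∈ 𝒮, ∑ i ∈ S, v i = c S) ∧ ∀ i ∈ A, v i = a i := by
  revert hl
  refine Finset.induction_on_max_value Finset.card 𝒮
    (fun _ => ⟨a, by simp, fun _ _ => rfl⟩) fun S 𝒮 hS hmax ih hl => ?_
  · obtain ⟨v, hv, hva⟩ := ih ⟨fun T hT => hl.nonempty T (mem_insert_of_mem hT),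
      fun T hT => hl.disjoint T (mem_insert_of_mem hT),
      fun T hT U hU => hl.chain T (mem_insert_of_mem hT) U (mem_insert_of_mem hU)⟩
    have hsub : ∀ T ∈ 𝒮, T ⊂ S := fun T hT => by
      have hne : T ≠ S := fun h => hS (h ▸ hT)
      rcases hl.chain T (mem_insert_of_mem hT) S (mem_insert_self _ _) with h | h
      · exact h.ssubset_of_ne hne
      · exact absurd (eq_of_subset_of_card_le h (hmax T hT)).symm hne
    -- `S` is the largest set, so it has an element `e` outside all the others. Changing coordinate
    -- `e` corrects the sum over `S` and disturbs nothing else.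
    obtain ⟨e, heS, he⟩ : ∃ e ∈ S, ∀ T ∈ 𝒮, e ∉ T := by
      rcases 𝒮.eq_empty_or_nonempty with rfl | hne
      · obtain ⟨e, he⟩ := hl.nonempty S (mem_insert_self _ _)
        exact ⟨e, he, by simp⟩
      · obtain ⟨T₀, hT₀, hm⟩ := exists_max_image 𝒮 Finset.card hne
        obtain ⟨e, he, he'⟩ := exists_of_ssubset (hsub T₀ hT₀)
        refine ⟨e, he, fun T hT heT => he' ?_⟩
        rcases hl.chain T (mem_insert_of_mem hT) T₀ (mem_insert_of_mem hT₀) with h | h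
        · exact h heT
        · exact eq_of_subset_of_card_le h (hm T hT) ▸ heT
    have heA : e ∉ A := disjoint_left.1 (hl.disjoint S (mem_insert_self _ _)) heS
    refine ⟨v + Pi.single e (c S - ∑ i ∈ S, v i), fun T hT => ?_, fun i hi => ?_⟩
    · simp only [Pi.add_apply, sum_add_distrib]
      rcases mem_insert.1 hT with rfl | hT
      · simp [heS]
      · simp [he T hT, hv T hT]
    · have : i ≠ e := fun h => heA (h ▸ hi)
      simp [this, hva i hi]

/-- The linear map that evaluates the functionals of a label. -/
def labelMap (𝒮 : Finset (Finset V)) (A : Finset V) : (V → ℝ) →ₗ[ℝ] (𝒮 ⊕ A → ℝ) :=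
  LinearMap.pi (Sum.elim (fun S => ∑ i ∈ S.1, LinearMap.proj i) fun i => LinearMap.proj i.1)

omit [Fintype V] [DecidableEq V] in
theorem mem_ker_labelMap {𝒮 : Finset (Finset V)} {A : Finset V} {v : V → ℝ} :
    v ∈ LinearMap.ker (labelMap 𝒮 A) ↔ (∀ S ∈ 𝒮, ∑ i ∈ S, v i = 0) ∧ ∀ i ∈ A, v i = 0 := by
  simp [labelMap, LinearMap.mem_ker, funext_iff]

/-- Rank-nullity: the functionals of a label are independent by `exists_values`. -/
theorem IsFaceLabel.finrank_ker {𝒮 : Finset (Finset V)} {A : Finset V} (hl : IsFaceLabel 𝒮 A) :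
    Module.finrank ℝ (LinearMap.ker (labelMap 𝒮 A)) + (#𝒮 + #A) = Fintype.card V := by
  have hs : Function.Surjective (labelMap 𝒮 A) := fun f => by
    obtain ⟨v, hv, hva⟩ := hl.exists_values
      (fun S => if h : S ∈ 𝒮 then f (Sum.inl ⟨S, h⟩) else 0)
      (fun i => if h : i ∈ A then f (Sum.inr ⟨i, h⟩) else 0)
    refine ⟨v, funext ?_⟩
    rintro (⟨S, hS⟩ | ⟨i, hi⟩)
    · simpa [labelMap, hS] using hv S hS
    · simpa [labelMap, hi] using hva i hi
  have := LinearMap.finrank_range_add_finrank_ker (labelMap 𝒮 A)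
  rw [LinearMap.range_eq_top.2 hs, finrank_top] at this
  simp at this
  omega

/-- From the point of `exists_relint`, a small step along any kernel vector stays in the face. -/
theorem IsStrictPolymatroid.vectorSpan_face {g : Finset V → ℝ} (hg : IsStrictPolymatroid g)
    {𝒮 : Finset (Finset V)} {A : Finset V} (hl : IsFaceLabel 𝒮 A) :
    vectorSpan ℝ (polymatroidFace g 𝒮 A) = LinearMap.ker (labelMap 𝒮 A) := by
  apply le_antisymm
  · refine Submodule.span_le.2 ?_
    rintro _ ⟨R, ⟨-, -, ht, hA⟩, R', ⟨-, -, ht', hA'⟩, rfl⟩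
    refine mem_ker_labelMap.2 ⟨fun S hS => ?_, fun i hi => ?_⟩
    · simp [sum_sub_distrib, ht S hS, ht' S hS]
    · simp [hA i hi, hA' i hi]
  · intro v hv
    obtain ⟨hv, hvA⟩ := mem_ker_labelMap.1 hv
    obtain ⟨R, hR, hpos, hlt⟩ := hg.exists_relint hl
    have e1 : ∀ᶠ ε in 𝓝[>] (0 : ℝ), ∀ i, i ∉ A → 0 + ε * -v i < R i :=
      eventually_all.2 fun i => by
        by_cases h : i ∈ A
        · exact Eventually.of_forall fun _ h' => absurd h h'
        · filter_upwards [eventually_add_mul_lt (-v i) (hpos i h)] with ε hε _ using hε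
    have e2 : ∀ᶠ ε in 𝓝[>] (0 : ℝ), ∀ S : Finset V, S.Nonempty → S ∉ 𝒮 →
        ∑ i ∈ S, R i + ε * ∑ i ∈ S, v i < g S := eventually_all.2 fun S => by
      by_cases h : S.Nonempty ∧ S ∉ 𝒮
      · filter_upwards [eventually_add_mul_lt (∑ i ∈ S, v i) (hlt S h.1 h.2)] with ε hε _ _
          using hε
      · exact Eventually.of_forall fun _ h1 h2 => absurd ⟨h1, h2⟩ h
    obtain ⟨ε, ⟨h1, h2⟩, hε⟩ := ((e1.and e2).and self_mem_nhdsWithin).exists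
    have hε : 0 < ε := hε
    have hsum : ∀ S : Finset V, ∑ i ∈ S, (R + ε • v) i = ∑ i ∈ S, R i + ε * ∑ i ∈ S, v i :=
      fun S => by simp [sum_add_distrib, mul_sum]
    have hmem : R + ε • v ∈ polymatroidFace g 𝒮 A := by
      refine ⟨fun i => ?_, fun S => ?_, fun S hS => ?_, fun i hi => ?_⟩
      · by_cases hi : i ∈ A
        · simp [hvA i hi, hR.1 i]
        · have := h1 i hi
          simp only [Pi.add_apply, Pi.smul_apply, smul_eq_mul]
          linarith
      · rw [hsum]
        by_cases hS : S ∈ 𝒮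
        · rw [hv S hS, mul_zero, add_zero]
          exact hR.2.1 S
        · rcases S.eq_empty_or_nonempty with rfl | hne
          · simp [hg.empty]
          · exact (h2 S hne hS).le
      · rw [hsum, hv S hS, mul_zero, add_zero]
        exact hR.2.2.1 S hS
      · simp [hvA i hi, hR.2.2.2 i hi]
    have := vsub_mem_vectorSpan ℝ hmem hR
    rw [vsub_eq_sub, add_sub_cancel_left] at this
    exact (Submodule.smul_mem_iff _ hε.ne').1 this

end Polymatroid

/-! ### Entropy identities and the chain rule. -/

section Entropy

variable {Ω α β : Type*} [Fintype Ω] [Fintype α] [Fintype β]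

/-- Entropy is invariant under injective recoding. -/
theorem shannonEntropy_comp_injective (p : Ω → ℝ) (U : Ω → α) {f : α → β}
    (hf : Function.Injective f) : shannonEntropy p (fun ω => f (U ω)) = shannonEntropy p U := by
  classical
  unfold shannonEntropy
  symm
  apply Finset.sum_of_injOn f hf.injOn (fun _ _ => Finset.mem_coe.2 (Finset.mem_univ _))
  -- Values outside the range of `f` have mass zero and contribute no entropy.
  · intro b _ hb
    rw [Finset.sum_eq_zero, Real.negMulLog_zero]
    intro ω hω
    refine absurd ?_ hb
    rw [← (Finset.mem_filter.1 hω).2]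
    exact ⟨U ω, by simp, rfl⟩
  · intro a _
    simp only [hf.eq_iff]

end Entropy

namespace MAC

variable {M : ℕ} (C : MAC.{u, v} M)

theorem sum_pmf {α : Type*} [Fintype α] (P : PMF α) : ∑ a, (P a).toReal = 1 := by
  rw [← ENNReal.toReal_sum fun a _ => P.apply_ne_top a, ← tsum_fintype (L := .unconditional _),
    P.tsum_coe, ENNReal.toReal_one]

theorem sum_joint : ∑ ω, C.joint ω = 1 := by
  classical
  simp only [joint]
  rw [Fintype.sum_prod_type]
  simp only [← Finset.mul_sum, sum_pmf, mul_one]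
  rw [← Fintype.prod_sum (fun i x => (C.P i x).toReal)]
  simp [sum_pmf]

theorem info_empty : C.info ∅ = 0 := by
  classical
  have h1 : shannonEntropy C.joint (C.inp ∅) = 0 := by
    unfold shannonEntropy
    refine Finset.sum_eq_zero fun a _ => ?_
    rw [← Real.negMulLog_one, ← C.sum_joint]
    congr 2
    ext ω
    simp [eq_iff_true_of_subsingleton]
  have h2 : shannonEntropy C.joint (fun ω => (C.inp ∅ ω, C.out ω)) =
      shannonEntropy C.joint C.out := by
    rw [← shannonEntropy_comp_injective C.joint (fun ω => (C.inp ∅ ω, C.out ω))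
      (f := Prod.snd) fun x y h => Prod.ext (Subsingleton.elim _ _) h]
  rw [info, mutualInfo, h1, h2]
  ring

/-- Splitting `X_{S ∪ T}` into `X_S` and `X_T`. -/
def splitInp (S T : Finset (Fin M)) (x : ∀ i : (S ∪ T : Finset (Fin M)), C.X i) :
    (∀ i : S, C.X i) × (∀ i : T, C.X i) :=
  (fun i => x ⟨i, Finset.mem_union_left _ i.2⟩, fun i => x ⟨i, Finset.mem_union_right _ i.2⟩)

/-- `S` and `T` may overlap, so the splitting is injective but need not be surjective. -/
theorem splitInp_injective (S T : Finset (Fin M)) : Function.Injective (C.splitInp S T) := by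
  intro x y h
  funext ⟨i, hi⟩
  rcases Finset.mem_union.1 hi with h' | h'
  · exact congrFun (Prod.ext_iff.1 h).1 ⟨i, h'⟩
  · exact congrFun (Prod.ext_iff.1 h).2 ⟨i, h'⟩

theorem splitInp_inp (S T : Finset (Fin M)) (ω : (∀ i, C.X i) × C.Y) :
    C.splitInp S T (C.inp (S ∪ T) ω) = (C.inp S ω, C.inp T ω) := rfl

theorem entropy_inp_inp (S T : Finset (Fin M)) :
    shannonEntropy C.joint (fun ω => (C.inp S ω, C.inp T ω)) =
      shannonEntropy C.joint (C.inp (S ∪ T)) := by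
  simp only [← splitInp_inp]
  exact shannonEntropy_comp_injective C.joint (C.inp (S ∪ T)) (C.splitInp_injective S T)

theorem entropy_inp_out_inp (S T : Finset (Fin M)) :
    shannonEntropy C.joint (fun ω => (C.inp S ω, C.out ω, C.inp T ω)) =
      shannonEntropy C.joint (fun ω => (C.inp (S ∪ T) ω, C.out ω)) := by
  have h : ∀ ω, (C.inp S ω, C.out ω, C.inp T ω) = ((C.splitInp S T (C.inp (S ∪ T) ω)).1, C.out ω,
      (C.splitInp S T (C.inp (S ∪ T) ω)).2) := fun _ => rfl
  simp only [h]
  refine shannonEntropy_comp_injective C.joint (fun ω => (C.inp (S ∪ T) ω, C.out ω))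
    (f := fun z => ((C.splitInp S T z.1).1, z.2, (C.splitInp S T z.1).2)) fun x y h => ?_
  simp only [Prod.mk.injEq] at h
  exact Prod.ext (C.splitInp_injective S T (Prod.ext h.1 h.2.2)) h.2.1

theorem entropy_out_inp (T : Finset (Fin M)) :
    shannonEntropy C.joint (fun ω => (C.out ω, C.inp T ω)) =
      shannonEntropy C.joint (fun ω => (C.inp T ω, C.out ω)) :=
  shannonEntropy_comp_injective C.joint (fun ω => (C.inp T ω, C.out ω))
    (f := Prod.swap) Prod.swap_injective

/-- The chain rule for mutual information. -/
theorem condInfo_eq (S T : Finset (Fin M)) : C.condInfo S T = C.info (S ∪ T) - C.info T := by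
  simp only [condInfo, condMutualInfo, info, mutualInfo, entropy_inp_inp, entropy_inp_out_inp,
    entropy_out_inp]
  ring

end MAC

/-! ### Counting chains. -/

section Counting

open Finset

open Classical in
/-- The number of face labels of codimension `k - D` without vanishing coordinates. -/
noncomputable def numChains (k D : ℕ) : ℕ :=
  #{𝒮 : Finset (Finset (Fin k)) | IsFaceLabel 𝒮 ∅ ∧ #𝒮 + D = k}

theorem numChains_eq_zero {k D : ℕ} (h : k < D) : numChains k D = 0 := by
  classical
  refine card_eq_zero.2 (filter_eq_empty_iff.2 fun 𝒮 _ h' => ?_)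
  omega

open Classical in
/-- Face labels that vanish on `A` correspond to chains in the complement of `A`. -/
theorem card_labels_compl {M : ℕ} (D : ℕ) (B : Finset (Fin M)) :
    #{𝒮 : Finset (Finset (Fin M)) | IsFaceLabel 𝒮 Bᶜ ∧ #𝒮 + D = #B} = numChains #B D := by
  symm
  let e : Fin #B ↪ Fin M := (B.orderEmbOfFin rfl).toEmbedding
  have he : ∀ i, e i ∈ B := fun i => B.orderEmbOfFin_mem rfl i
  let φ : Finset (Fin #B) ↪ Finset (Fin M) := (mapEmbedding e).toEmbedding
  have hφ : ∀ S T, φ S ⊆ φ T ↔ S ⊆ T := fun S T => map_subset_map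
  refine card_bij (fun 𝒮 _ => 𝒮.map φ) ?_ (fun _ _ _ _ h => map_injective φ h) ?_
  · intro 𝒮 h
    simp only [mem_filter, mem_univ, true_and, card_map] at h ⊢
    refine ⟨⟨?_, ?_, ?_⟩, h.2⟩
    · simp only [mem_map, forall_exists_index, and_imp, forall_apply_eq_imp_iff₂]
      exact fun S hS => (map_nonempty (f := e)).2 (h.1.nonempty S hS)
    · simp only [mem_map, forall_exists_index, and_imp, forall_apply_eq_imp_iff₂]
      refine fun S hS => disjoint_left.2 fun i hi => ?_
      obtain ⟨j, -, rfl⟩ := mem_map.1 (show i ∈ S.map e from hi)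
      simpa using he j
    · simp only [mem_map, forall_exists_index, and_imp, forall_apply_eq_imp_iff₂, hφ]
      exact fun S hS T hT => h.1.chain S hS T hT
  · intro 𝒯 h
    simp only [mem_filter, mem_univ, true_and] at h
    -- A set disjoint from `Bᶜ` lies in `B`, the range of `e`.
    have hmap : ∀ T ∈ 𝒯, ∃ S, φ S = T := fun T hT => by
      refine ⟨univ.filter fun i => e i ∈ T, ?_⟩
      ext i
      change i ∈ map e _ ↔ _
      simp only [mem_map, mem_filter, mem_univ, true_and]
      constructor
      · rintro ⟨j, hj, rfl⟩
        exact hj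
      · intro hi
        have hB : i ∈ B := by
          simpa using disjoint_left.1 (h.1.disjoint T hT) hi
        obtain ⟨j, rfl⟩ : i ∈ Set.range (B.orderEmbOfFin rfl) := by
          rw [range_orderEmbOfFin]
          exact hB
        exact ⟨j, hi, rfl⟩
    let 𝒮 : Finset (Finset (Fin #B)) := univ.filter fun S => φ S ∈ 𝒯
    have h𝒮 : 𝒮.map φ = 𝒯 := by
      ext T
      simp only [𝒮, mem_map, mem_filter, mem_univ, true_and]
      constructor
      · rintro ⟨S, hS, rfl⟩
        exact hS
      · intro hT
        obtain ⟨S, rfl⟩ := hmap T hT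
        exact ⟨S, hT, rfl⟩
    refine ⟨𝒮, ?_, h𝒮⟩
    simp only [mem_filter, mem_univ, true_and]
    refine ⟨⟨fun S hS => ?_, fun S _ => disjoint_empty_right S, fun S hS T hT => ?_⟩, ?_⟩
    · exact (map_nonempty (f := e)).1 (h.1.nonempty _ (mem_filter.1 hS).2)
    · simpa only [hφ] using h.1.chain _ (mem_filter.1 hS).2 _ (mem_filter.1 hT).2
    · rw [← card_map φ, h𝒮, h.2]

end Counting

/-! ### The region as a strict polymatroid, and the count of its faces. -/

namespace MAC

open Finset

variable {M : ℕ} (C : MAC.{u, v} M)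

/-- The rank function of the region. -/
noncomputable def rank (S : Finset (Fin M)) : ℝ := C.condInfo S Sᶜ

theorem rank_eq (S : Finset (Fin M)) : C.rank S = C.info univ - C.info Sᶜ := by
  rw [rank, condInfo_eq, union_compl]

variable {C}

/-- Non-degeneracy makes `info` strictly supermodular and strictly increasing; complementation turns
this into strict submodularity and monotonicity of `rank`. -/
theorem NonDegenerated.isStrictPolymatroid (hC : C.NonDegenerated) :
    IsStrictPolymatroid C.rank := by
  have key : ∀ P Q : Finset (Fin M), ¬ P ⊆ Q → ¬ Q ⊆ P →
      C.info P + C.info Q < C.info (P ∪ Q) + C.info (P ∩ Q) := fun P Q h1 h2 => by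
    obtain ⟨i, hiP, hiQ⟩ := not_subset.1 h1
    obtain ⟨j, hjQ, hjP⟩ := not_subset.1 h2
    have := hC.2 (P \ Q) (P ∩ Q) Q
      ((empty_ssubset).2 ⟨i, mem_sdiff.2 ⟨hiP, hiQ⟩⟩)
      (ssubset_univ_iff.2 fun h => (mem_sdiff.1 (h ▸ mem_univ j)).2 hjQ)
      ⟨inter_subset_right, fun h => hjP (mem_inter.1 (h hjQ)).1⟩
      (ssubset_univ_iff.2 fun h => hiQ (h ▸ mem_univ i))
      (sdiff_inter_self _ _)
    rw [condInfo_eq, condInfo_eq, sdiff_union_inter, sdiff_union_self_eq_union] at this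
    linarith
  have mono : ∀ S T : Finset (Fin M), S ⊂ T → C.info S < C.info T := fun S T h => by
    obtain ⟨i, hiT, hiS⟩ := exists_of_ssubset h
    have hpos : 0 < C.info (T \ S) := hC.1 _ ⟨i, mem_sdiff.2 ⟨hiT, hiS⟩⟩
    -- For empty `S` only the first clause of non-degeneracy applies; otherwise conditioning on
    -- `X_S` raises the already positive information of `T \ S`.
    rcases S.eq_empty_or_nonempty with rfl | ⟨j, hj⟩
    · rwa [sdiff_empty, ← C.info_empty] at hpos
    · have := hC.2 (T \ S) ∅ S
        ((empty_ssubset).2 ⟨i, mem_sdiff.2 ⟨hiT, hiS⟩⟩)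
        (ssubset_univ_iff.2 fun h => (mem_sdiff.1 (h ▸ mem_univ j)).2 hj)
        ((empty_ssubset).2 ⟨j, hj⟩)
        (ssubset_univ_iff.2 fun h => hiS (h ▸ mem_univ i))
        (sdiff_inter_self _ _)
      rw [condInfo_eq, condInfo_eq, union_empty, sdiff_union_of_subset h.1, C.info_empty] at this
      linarith
  refine ⟨by simp [rank_eq], fun S T h => ?_, fun S T h1 h2 => ?_⟩
  · rw [rank_eq, rank_eq]
    linarith [mono Tᶜ Sᶜ (compl_ssubset_compl.2 h)]
  · simp only [rank_eq, compl_union, compl_inter]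
    linarith [key Sᶜ Tᶜ (fun h => h2 (compl_subset_compl.1 h))
      fun h => h1 (compl_subset_compl.1 h)]

variable (C)

theorem labelledFace_eq (𝒮 : Finset (Finset (Fin M))) (A : Finset (Fin M)) :
    C.labelledFace 𝒮 A = polymatroidFace C.rank 𝒮 A := by
  ext R
  simp only [labelledFace, frontFacet, backFacet, region, polymatroidFace, rank, Set.mem_inter_iff,
    Set.mem_iInter, Set.mem_ofPred_eq]
  constructor
  · rintro ⟨⟨⟨h0, hle⟩, hS⟩, -, hA⟩
    exact ⟨h0, hle, fun S h => (hS S h).2.2, fun i h => (hA i h).2.2⟩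
  · rintro ⟨h0, hle, hS, hA⟩
    exact ⟨⟨⟨h0, hle⟩, fun S h => ⟨⟨h0, hle⟩, h0, hS S h⟩⟩, ⟨h0, hle⟩,
      fun i h => ⟨⟨h0, hle⟩, h0, hA i h⟩⟩

/-- Labelled faces are faces: sum up the inequalities in the label. -/
theorem isFace_labelledFace (𝒮 : Finset (Finset (Fin M))) (A : Finset (Fin M)) :
    C.IsFace (C.labelledFace 𝒮 A) := by
  classical
  let a (i : Fin M) : ℝ := (∑ S ∈ 𝒮, if i ∈ S then 1 else 0) - if i ∈ A then 1 else 0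
  have ha : ∀ R : Fin M → ℝ, ∑ i, R i * a i = ∑ S ∈ 𝒮, ∑ i ∈ S, R i - ∑ i ∈ A, R i := by
    intro R
    simp only [a, mul_sub, sum_sub_distrib, mul_sum]
    rw [sum_comm]
    simp
  have hS : ∀ R ∈ C.region, ∀ S ∈ 𝒮, ∑ i ∈ S, R i ≤ C.rank S := fun R hR S _ => hR.2 S
  have hA : ∀ R ∈ C.region, ∀ i ∈ A, 0 ≤ R i := fun R hR i _ => hR.1 i
  refine ⟨a, ∑ S ∈ 𝒮, C.rank S, fun R hR => ?_, ?_⟩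
  · rw [ha]
    linarith [sum_le_sum (hS R hR), sum_nonneg (hA R hR)]
  · rw [labelledFace_eq]
    ext R
    simp only [Set.mem_inter_iff, Set.mem_ofPred_eq, ha]
    constructor
    · rintro ⟨h0, hle, ht, hz⟩
      exact ⟨⟨h0, hle⟩, h0, by rw [sum_congr rfl ht, sum_eq_zero hz, sub_zero]⟩
    -- A sum of valid inequalities is tight only if each of them is.
    · rintro ⟨hR, -, h⟩
      have h1 := sum_le_sum (hS R hR)
      have h2 := sum_nonneg (hA R hR)
      exact ⟨hR.1, hR.2, (sum_eq_sum_iff_of_le (hS R hR)).1 (by linarith),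
        (sum_eq_zero_iff_of_nonneg (hA R hR)).1 (by linarith)⟩

variable {C}

theorem NonDegenerated.hasDim_labelledFace_iff (hC : C.NonDegenerated)
    {𝒮 : Finset (Finset (Fin M))} {A : Finset (Fin M)} (hne : ∀ S ∈ 𝒮, S.Nonempty) (D : ℕ) :
    HasDim (C.labelledFace 𝒮 A) D ↔ IsFaceLabel 𝒮 A ∧ #𝒮 + #A + D = M := by
  have hg := hC.isStrictPolymatroid
  rw [labelledFace_eq, HasDim, direction_affineSpan]
  constructor
  · rintro ⟨hF, h⟩
    have hl := hg.isFaceLabel hne hF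
    have := hl.finrank_ker
    rw [← hg.vectorSpan_face hl, h, Fintype.card_fin] at this
    exact ⟨hl, by omega⟩
  · rintro ⟨hl, h⟩
    obtain ⟨R, hR, -⟩ := hg.exists_relint hl
    have := hl.finrank_ker
    rw [← hg.vectorSpan_face hl, Fintype.card_fin] at this
    exact ⟨⟨R, hR⟩, by omega⟩

theorem NonDegenerated.labelledFace_inj (hC : C.NonDegenerated)
    {𝒮 𝒯 : Finset (Finset (Fin M))} {A B : Finset (Fin M)} (h𝒮 : IsFaceLabel 𝒮 A)
    (h𝒯 : IsFaceLabel 𝒯 B) (h : C.labelledFace 𝒮 A = C.labelledFace 𝒯 B) : 𝒮 = 𝒯 ∧ A = B := by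
  have hg := hC.isStrictPolymatroid
  rw [labelledFace_eq, labelledFace_eq] at h
  obtain ⟨h1, h2⟩ := hg.label_subset h𝒮 h𝒯 h.ge
  obtain ⟨h3, h4⟩ := hg.label_subset h𝒯 h𝒮 h.le
  exact ⟨h1.antisymm h3, h2.antisymm h4⟩

/-- Labels biject with faces, so the count does not depend on the channel. -/
theorem NonDegenerated.numFrontFaces_eq (hC : C.NonDegenerated) (D : ℕ) :
    C.numFrontFaces D = numChains M D := by
  classical
  have : {F | C.IsFrontFace F ∧ HasDim F D} = (fun 𝒮 => C.labelledFace 𝒮 ∅) ''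
      ({𝒮 : Finset (Finset (Fin M)) | IsFaceLabel 𝒮 ∅ ∧ #𝒮 + D = M} :
        Finset (Finset (Finset (Fin M)))) := by
    ext F
    simp only [Set.mem_ofPred_eq, coe_filter, mem_univ, true_and, Set.mem_image]
    constructor
    · rintro ⟨⟨-, 𝒮, hne, rfl⟩, h⟩
      exact ⟨𝒮, by simpa using (hC.hasDim_labelledFace_iff hne D).1 h, rfl⟩
    · rintro ⟨𝒮, h, rfl⟩
      exact ⟨⟨C.isFace_labelledFace 𝒮 ∅, 𝒮, h.1.nonempty, rfl⟩,
        (hC.hasDim_labelledFace_iff h.1.nonempty D).2 (by simpa using h)⟩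
  rw [numFrontFaces, this, Set.InjOn.ncard_image, Set.ncard_coe_finset, numChains]
  intro 𝒮 h𝒮 𝒯 h𝒯 h
  simp only [coe_filter, mem_univ, true_and, Set.mem_ofPred_eq] at h𝒮 h𝒯
  exact (hC.labelledFace_inj h𝒮.1 h𝒯.1 h).1

open Classical in
theorem NonDegenerated.numBackFaces_eq (hC : C.NonDegenerated) (D : ℕ) :
    C.numBackFaces D = ∑ A : Finset (Fin M) with A.Nonempty,
      #{𝒮 : Finset (Finset (Fin M)) | IsFaceLabel 𝒮 A ∧ #𝒮 + D = #Aᶜ} := by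
  have hcard : ∀ (𝒮 : Finset (Finset (Fin M))) (A : Finset (Fin M)),
      #𝒮 + D = #Aᶜ ↔ #𝒮 + #A + D = M := fun 𝒮 A => by
    have := card_add_card_compl A
    rw [Fintype.card_fin] at this
    omega
  have : {F | C.IsBackFace F ∧ HasDim F D} =
      (fun p : Σ _ : Finset (Fin M), Finset (Finset (Fin M)) => C.labelledFace p.2 p.1) ''
      ((univ.filter fun A : Finset (Fin M) => A.Nonempty).sigma fun A =>
        univ.filter fun 𝒮 : Finset (Finset (Fin M)) => IsFaceLabel 𝒮 A ∧ #𝒮 + D = #Aᶜ :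
        Finset (Σ _ : Finset (Fin M), Finset (Finset (Fin M)))) := by
    ext F
    simp only [hcard, Set.mem_ofPred_eq, mem_coe, mem_sigma, mem_filter, mem_univ, true_and,
      Set.mem_image]
    constructor
    · rintro ⟨⟨-, 𝒮, A, hne, hA, rfl⟩, h⟩
      exact ⟨⟨A, 𝒮⟩, ⟨hA, (hC.hasDim_labelledFace_iff hne D).1 h⟩, rfl⟩
    · rintro ⟨⟨A, 𝒮⟩, ⟨hA, h⟩, rfl⟩
      exact ⟨⟨C.isFace_labelledFace 𝒮 A, 𝒮, A, h.1.nonempty, hA, rfl⟩,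
        (hC.hasDim_labelledFace_iff h.1.nonempty D).2 h⟩
  rw [numBackFaces, this, Set.InjOn.ncard_image, Set.ncard_coe_finset, card_sigma]
  rintro ⟨A, 𝒮⟩ h𝒮 ⟨B, 𝒯⟩ h𝒯 h
  simp only [mem_coe, mem_sigma, mem_filter, mem_univ, true_and] at h𝒮 h𝒯
  obtain ⟨rfl, rfl⟩ := hC.labelledFace_inj h𝒮.2.1 h𝒯.2.1 h
  rfl

theorem NonDegenerated.numBackFaces_eq_sum (hC : C.NonDegenerated) (D : ℕ) :
    C.numBackFaces D = ∑ i ∈ Ico D M, M.choose i * numChains i D := by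
  classical
  rw [hC.numBackFaces_eq, sum_filter, ← Equiv.sum_comp compl_involutive.toPerm]
  -- Here `B = Aᶜ`, and `A` is non-empty exactly when `#B < M`; subsets are then grouped by size.
  calc _ = ∑ B ∈ (univ : Finset (Fin M)).powerset, if #B < M then numChains #B D else 0 := by
        rw [powerset_univ]
        refine sum_congr rfl fun B _ => ?_
        have hB : (Bᶜ).Nonempty ↔ #B < M := by
          rw [← card_pos, card_compl, Fintype.card_fin]
          omega
        simp only [Function.Involutive.coe_toPerm, hB, compl_compl, card_labels_compl]
    _ = ∑ i ∈ range (M + 1), if i < M then M.choose i * numChains i D else 0 := by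
        rw [sum_powerset_apply_card fun i => if i < M then numChains i D else 0]
        simp
    _ = ∑ i ∈ Ico D M, M.choose i * numChains i D := by
        rw [← sum_filter]
        symm
        refine sum_subset (fun i hi => ?_) fun i hi hi' => ?_
        · simp only [mem_Ico, mem_filter, mem_range] at hi ⊢
          omega
        · simp only [mem_Ico, mem_filter, mem_range] at hi hi'
          rw [numChains_eq_zero (by omega), mul_zero]

end MAC

theorem mainTheorem6 (M D : ℕ) (C : MAC.{u, v} M) (hC : C.NonDegenerated)
    (C' : ∀ i : ℕ, MAC.{u', v'} i) (hC' : ∀ i ∈ Finset.Ico D M, (C' i).NonDegenerated) :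
    C.numBackFaces D = ∑ i ∈ Finset.Ico D M, M.choose i * (C' i).numFrontFaces D := by
  rw [hC.numBackFaces_eq_sum]
  exact Finset.sum_congr rfl fun i hi => by rw [(hC' i hi).numFrontFaces_eq]
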